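/- Let $d\ge 1$, $s\in\mathbb R$, $2\le p\le\infty$, and let $Uf(t,\cdot)=U(t)f=e^{it\Delta}f$ denote the solution of $i\partial_t u+\Delta u=0$ on $\mathbb R\times\mathbb R^d$ with $u(0)=f$. Write $\langle\xi\rangle=(1+|\xi|^2)^{1/2}$, $\|f\|_{L^r_s}=\|\langle D\rangle^s f\|_{L^r(\mathbb R^d)}$ with $D=-i\nabla$, and $$\|f\|_{M^s_{p,q}}=\Big(\sum_{k\in\mathbb Z^d}\langle k\rangle^{qs}\|\Box_k f\|_{L^p(\mathbb R^d)}^q\Big)^{1/q}$$ (supremum over $k$ if $q=\infty$), where $\Box_k=\sigma(D-k)$ and $\sigma\in C_c^\infty(\mathbb R^d)$ is any fixed function with $\sum_{k\in\mathbb Z^d}\sigma(\xi-k)=1$ for all $\xi$. By convention $1/\infty=0$. In each estimate below the constant $C$ is independent of $f$, and the estimate is only required for Schwartz functions $f$. (i) Let $1\le q\le\infty$. If there is $C$ with $$\|Uf\|_{L^p([-1,1]\times\mathbb R^d)}\le C\,\|f\|_{M^s_{p,q}(\mathbb R^d)}\quad\text{for all } f\in\mathcal S(\mathbb R^d),$$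 then $$s\ge\max\Big(0,\;d-\frac{d+2}{p}-\frac dq\Big).$$ (ii) Let $1\le q,r\le\infty$. If there is $C$ with $$\|Uf\|_{L^p_t(I;L^q_x(\mathbb R^d))}\le C\,\|f\|_{L^r_s(\mathbb R^d)}\quad\text{for all } f\in\mathcal S(\mathbb R^d)$$ for $I=[-1,1]$, then $$s\ge\max\Big(0,\;d-\frac dq-\frac2p-\frac dr\Big)\quad\text{and}\quad q\ge r.$$ (iii) Let $1\le q,r\le\infty$. If the estimate in (ii) holds for $I=\mathbb R$, then the conclusions of (ii) hold and, in addition, $$\frac2p+\frac dq\le\frac dr.$$ -/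

import Mathlib

open MeasureTheory Set Real
open scoped ENNReal NNReal SchwartzMap FourierTransform ContDiff

noncomputable section

/-- The Fourier multiplier `m(D)`, `D = -i∇`, applied to a Schwartz function `f` on `ℝ^d`:
`(m(D) f)(x) = (2π)^{-d} ∫ e^{i x·η} m(η) (∫ e^{-i y·η} f(y) dy) dη`.
Mathlib's Fourier transform has the kernel `e^{-2πi x·ξ}`, so the frequency variable is
`η = 2π ξ`. -/
def fourierMult {d : ℕ} (m : EuclideanSpace ℝ (Fin d) → ℂ) (f : 𝓢(EuclideanSpace ℝ (Fin d), ℂ)) :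
    EuclideanSpace ℝ (Fin d) → ℂ :=
  𝓕⁻ (fun ξ : EuclideanSpace ℝ (Fin d) => m ((2 * π) • ξ) * 𝓕 f ξ)

/-- The free Schrödinger evolution `U(t) f = e^{itΔ} f`, with symbol `e^{-it|η|²}`. -/
def schrodingerProp {d : ℕ} (t : ℝ) (f : 𝓢(EuclideanSpace ℝ (Fin d), ℂ)) :
    EuclideanSpace ℝ (Fin d) → ℂ :=
  fourierMult (fun η => Complex.exp (-(Complex.I * (t * ‖η‖ ^ 2 : ℝ)))) f

/-- The Japanese bracket `⟨x⟩ = (1 + |x|²)^{1/2}`. -/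
def japaneseBracket {d : ℕ} (x : EuclideanSpace ℝ (Fin d)) : ℝ :=
  Real.sqrt (1 + ‖x‖ ^ 2)

/-- The point of `ℝ^d` given by `k ∈ ℤ^d`. -/
def latticePoint {d : ℕ} (k : Fin d → ℤ) : EuclideanSpace ℝ (Fin d) :=
  WithLp.toLp 2 (fun i => (k i : ℝ))

/-- `σ ∈ C_c^∞(ℝ^d)` generates, by integer translations, a partition of unity:
`∑_{k ∈ ℤ^d} σ(ξ - k) = 1` for all `ξ`.  (All such `σ` give equivalent modulation norms.) -/
structure IsUniformPartition {d : ℕ} (σ : EuclideanSpace ℝ (Fin d) → ℂ) : Prop where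
  smooth : ContDiff ℝ ∞ σ
  hasCompactSupport : HasCompactSupport σ
  hasSum_one : ∀ ξ, HasSum (fun k : Fin d → ℤ => σ (ξ - latticePoint k)) 1

/-- The frequency localization `□_k f`, with symbol `σ_k(η) = σ(η - k)`. -/
def boxOp {d : ℕ} (σ : EuclideanSpace ℝ (Fin d) → ℂ) (k : Fin d → ℤ)
    (f : 𝓢(EuclideanSpace ℝ (Fin d), ℂ)) : EuclideanSpace ℝ (Fin d) → ℂ :=
  fourierMult (fun η => σ (η - latticePoint k)) f

/-- The norm of `M^s_{p,q}(ℝ^d)`: the `ℓ^q(ℤ^d)` norm of `k ↦ ⟨k⟩^s ‖□_k f‖_{L^p}`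
(for `q = ∞` the supremum). -/
def modulationNorm {d : ℕ} (σ : EuclideanSpace ℝ (Fin d) → ℂ) (s : ℝ) (p q : ℝ≥0∞)
    (f : 𝓢(EuclideanSpace ℝ (Fin d), ℂ)) : ℝ≥0∞ :=
  eLpNorm (fun k : Fin d → ℤ =>
    ENNReal.ofReal (japaneseBracket (latticePoint k) ^ s) * eLpNorm (boxOp σ k f) p volume)
    q Measure.count

/-- The norm of `L^r_s(ℝ^d) = ⟨D⟩^{-s} L^r(ℝ^d)`, that is `‖⟨D⟩^s f‖_{L^r}`. -/
def sobolevNorm {d : ℕ} (s : ℝ) (r : ℝ≥0∞) (f : 𝓢(EuclideanSpace ℝ (Fin d), ℂ)) : ℝ≥0∞ :=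
  eLpNorm (fourierMult (fun η => ((japaneseBracket η ^ s : ℝ) : ℂ)) f) r volume

/-- The estimate `‖U f‖_{L^p([-1,1] × ℝ^d)} ≤ C ‖f‖_{M^s_{p,q}(ℝ^d)}` for Schwartz data,
with `C` independent of `f`. -/
def ModulationSmoothing (d : ℕ) (σ : EuclideanSpace ℝ (Fin d) → ℂ) (s : ℝ) (p q : ℝ≥0∞) : Prop :=
  ∃ C : ℝ≥0, ∀ f : 𝓢(EuclideanSpace ℝ (Fin d), ℂ),
    eLpNorm (fun z : ℝ × EuclideanSpace ℝ (Fin d) => schrodingerProp z.1 f z.2) p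
      (volume.restrict (Icc (-1 : ℝ) 1 ×ˢ univ)) ≤ C * modulationNorm σ s p q f

/-- The estimate `‖U f‖_{L^p_t(I; L^q_x(ℝ^d))} ≤ C ‖f‖_{L^r_s(ℝ^d)}` for Schwartz data,
with `C` independent of `f`. -/
def StrichartzEstimate (d : ℕ) (I : Set ℝ) (s : ℝ) (p q r : ℝ≥0∞) : Prop :=
  ∃ C : ℝ≥0, ∀ f : 𝓢(EuclideanSpace ℝ (Fin d), ℂ),
    eLpNorm (fun t : ℝ => eLpNorm (schrodingerProp t f) q volume) p (volume.restrict I)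
      ≤ C * sobolevNorm s r f

end

/-!
All the conditions come from testing the estimates on one family of functions. Let `φ` be a smooth
cutoff and let `f` be the Schwartz function with Fourier transform
`e^{it₀|η|²} ⟨η⟩^{-s} φ((ξ - κ)/R)`, where `η = 2πξ` (`testData`); it has frequency about `2πκ`,
frequency scale `R`, and it focuses at time `t₀`.

*Left-hand side.* The integral that gives `U(t)f(x)` has a nonnegative amplitude and a phase that
varies by at most `1` on the support of `φ((ξ - κ)/R)` as soon as `|t - t₀| ≲ R⁻²` and
`|x - 4π(t - t₀)κ| ≲ R⁻¹`. There is no cancellation there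
(`le_norm_schrodingerProp_testData`), which bounds the space-time norms of `U f` from below by
explicit powers of `R` (`exists_le_eLpNorm_eLpNorm`, `exists_le_eLpNorm_prod`).

*Right-hand side.* The weight `⟨η⟩^{-s}` turns the norm of `L^r_s` into the `L^r` norm of the same
data with `s = 0` (`sobolevNorm_testData`). For `t₀ = 0` this norm is found by scaling. For
`t₀ = 1/2` and `r ≥ 2` it is `O(R^{d/r})` (`exists_eLpNorm_testData_half_le`), by interpolation
between Plancherel's theorem and the dispersive bound `O(1)` in `L^∞`; the latter follows from the
Fourier transform of a complex Gaussian (`norm_integral_fourier_mul_gaussian_le`). For the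
modulation norm (with weight `1` in the data), `O(R^d)` pieces `□_k f` do not vanish, and each is
bounded in `L²` and in `L^∞`, hence in `L^p` (`exists_modulationNorm_testData_le`).

The conditions are then read off by comparing powers:
* `0 ≤ s`: `R = 1` and `|κ| → ∞`;
* the other lower bounds on `s`: `κ = 0` and `R → ∞`, with `t₀ = 0` for the modulation space and for
  `r ≤ 2`, and with `t₀ = 1/2` for `r ≥ 2`. For `r ≤ 2` this gives
  `d/r - d/q - 2/p ≤ s`, which is stronger than what is claimed;
* `r ≤ q`, and `2/p + d/q ≤ d/r` if the time interval is `ℝ`: `κ = 0` and `R → 0`, where `U(t)f`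
  does not change much for `|t| ≲ 1`, respectively for `|t| ≲ R⁻²`.
-/

noncomputable section

open Metric Complex

variable {d : ℕ}

local notation "E" => EuclideanSpace ℝ (Fin d)

/-! ### Lower and upper bounds for `L^p` norms -/

lemma one_div_toReal_eq (p : ℝ≥0∞) : 1 / p.toReal = (p⁻¹).toReal := by
  rw [ENNReal.toReal_inv, one_div]

lemma mul_measure_rpow_le_eLpNorm {α ε : Type*} [MeasurableSpace α] [ENorm ε] {μ : Measure α}
    {p : ℝ≥0∞} (hp : p ≠ 0) {A : Set α} (hA : MeasurableSet A) (hμA : μ A ≠ 0) {c : ℝ≥0∞}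
    {F : α → ε} (hF : ∀ x ∈ A, c ≤ ‖F x‖ₑ) :
    c * μ A ^ (p⁻¹).toReal ≤ eLpNorm F p μ := by
  have h := eLpNorm_indicator_const' (c := c) hA hμA hp
  rw [one_div_toReal_eq] at h
  calc c * μ A ^ (p⁻¹).toReal = eLpNorm (A.indicator fun _ => c) p μ := by rw [h]; rfl
    _ ≤ eLpNorm F p μ := by
      refine eLpNorm_mono_enorm fun x => ?_
      by_cases hx : x ∈ A
      · simpa [hx] using hF x hx
      · simp [hx]

lemma eLpNorm_le_mul_measure_rpow {α ε : Type*} [MeasurableSpace α] [ENorm ε] {μ : Measure α}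
    (p : ℝ≥0∞) {A : Set α} {c : ℝ≥0∞}
    {F : α → ε} (hF : ∀ x ∈ A, ‖F x‖ₑ ≤ c) (hF0 : ∀ x ∉ A, ‖F x‖ₑ = 0) :
    eLpNorm F p μ ≤ c * μ A ^ (p⁻¹).toReal := by
  have h := eLpNorm_indicator_const_le (s := A) (μ := μ) c p
  rw [one_div_toReal_eq] at h
  refine le_trans (eLpNorm_mono_enorm fun x => ?_) h
  by_cases hx : x ∈ A
  · simpa [hx] using hF x hx
  · simp [hx, hF0 x hx]

/-- Interpolation between `L^2` and `L^∞`. -/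
lemma eLpNorm_le_rpow_mul_rpow {α F : Type*} [MeasurableSpace α] [NormedAddCommGroup F]
    {μ : Measure α} {p : ℝ≥0∞} (hp : 2 ≤ p) {f : α → F}
    {A B : ℝ≥0∞} (hA : ∀ x, ‖f x‖ₑ ≤ A) (hA' : A ≠ ⊤) (hB : eLpNorm f 2 μ ≤ B) :
    eLpNorm f p μ ≤ A ^ (1 - 2 * (p⁻¹).toReal) * B ^ (2 * (p⁻¹).toReal) := by
  rcases eq_or_ne p ⊤ with rfl | hpt
  · simp only [eLpNorm_exponent_top, ENNReal.inv_top, ENNReal.toReal_zero, mul_zero, sub_zero,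
      ENNReal.rpow_one, ENNReal.rpow_zero, mul_one]
    exact essSup_le_of_ae_le _ (Filter.Eventually.of_forall hA)
  have hp0 : p ≠ 0 := (lt_of_lt_of_le (by norm_num) hp).ne'
  have hpr : 2 ≤ p.toReal := by simpa using ENNReal.toReal_mono hpt hp
  have hpos : 0 < p.toReal := by linarith
  rw [eLpNorm_eq_lintegral_rpow_enorm_toReal (by norm_num) (by norm_num)] at hB
  rw [eLpNorm_eq_lintegral_rpow_enorm_toReal hp0 hpt, ENNReal.toReal_inv]
  simp only [ENNReal.toReal_ofNat, one_div] at hB ⊢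
  have h1 : ∫⁻ x, ‖f x‖ₑ ^ p.toReal ∂μ
      ≤ A ^ (p.toReal - 2) * ∫⁻ x, ‖f x‖ₑ ^ (2 : ℝ) ∂μ := by
    rw [← lintegral_const_mul' _ _ (ENNReal.rpow_ne_top_of_nonneg (by linarith) hA')]
    refine lintegral_mono fun x => ?_
    calc ‖f x‖ₑ ^ p.toReal = ‖f x‖ₑ ^ (p.toReal - 2) * ‖f x‖ₑ ^ (2 : ℝ) := by
          rw [← ENNReal.rpow_add_of_nonneg _ _ (by linarith) (by norm_num)]; congr 1; ring
      _ ≤ _ := mul_le_mul' (ENNReal.rpow_le_rpow (hA x) (by linarith)) le_rfl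
  have h2 : ∫⁻ x, ‖f x‖ₑ ^ (2 : ℝ) ∂μ ≤ B ^ (2 : ℝ) := by
    calc _ = ((∫⁻ x, ‖f x‖ₑ ^ (2 : ℝ) ∂μ) ^ (2 : ℝ)⁻¹) ^ (2 : ℝ) := by
          rw [← ENNReal.rpow_mul]; norm_num
      _ ≤ _ := by gcongr
  calc (∫⁻ x, ‖f x‖ₑ ^ p.toReal ∂μ) ^ p.toReal⁻¹
      ≤ (A ^ (p.toReal - 2) * B ^ (2 : ℝ)) ^ p.toReal⁻¹ := by
        gcongr; exact h1.trans (by gcongr)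
    _ = _ := by
        rw [ENNReal.mul_rpow_of_nonneg _ _ (by positivity), ← ENNReal.rpow_mul,
          ← ENNReal.rpow_mul]
        congr 2
        field_simp

lemma le_of_forall_mul_rpow_le {c C α β : ℝ} (hc : 0 < c)
    (h : ∀ N : ℝ, 1 ≤ N → c * N ^ α ≤ C * N ^ β) : α ≤ β := by
  by_contra! hlt
  have ht := tendsto_rpow_atTop (sub_pos.2 hlt)
  obtain ⟨N, hN, hN1⟩ := ((ht.eventually_gt_atTop (C / c)).and
    (Filter.eventually_ge_atTop 1)).exists
  have hN0 : 0 < N := by linarith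
  have := h N hN1
  rw [rpow_sub hN0, div_lt_div_iff₀ hc (by positivity)] at hN
  linarith

/-- Dilations act on the `L^p` norm by a power of the dilation factor. -/
lemma eLpNorm_comp_smul (F : E → ℂ) (hF : Continuous F) {R : ℝ} (hR : 0 < R) {p : ℝ≥0∞} :
    eLpNorm (fun x => F (R • x)) p volume
      = ENNReal.ofReal (R ^ (-(d * (p⁻¹).toReal))) * eLpNorm F p volume := by
  have hmap : Measure.map (fun x : E => R • x) volume
      = ENNReal.ofReal ((R ^ d)⁻¹) • (volume : Measure E) := by
    rw [Measure.map_addHaar_smul _ hR.ne', finrank_euclideanSpace_fin, abs_of_pos (by positivity)]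
  have h := eLpNorm_map_measure (p := p) (g := F) (f := fun x : E => R • x) (μ := volume)
    (by rw [hmap]; exact hF.aestronglyMeasurable)
    (by fun_prop)
  rw [show (fun x => F (R • x)) = F ∘ fun x => R • x from rfl, ← h, hmap,
    eLpNorm_smul_measure_of_ne_zero (by simp; positivity), smul_eq_mul,
    ENNReal.toReal_div, ENNReal.toReal_one, one_div_toReal_eq,
    ENNReal.ofReal_rpow_of_pos (by positivity)]
  congr 2
  rw [← Real.rpow_natCast, ← Real.rpow_neg hR.le, ← Real.rpow_mul hR.le]
  ring_nf

/-! ### The test data -/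

/-- A smooth cutoff on `ℝ^d`, equal to `1` on the ball of radius `1/2` and supported in the unit
ball. -/
def cutoff (d : ℕ) : ContDiffBump (0 : EuclideanSpace ℝ (Fin d)) :=
  ⟨1 / 2, 1, by norm_num, by norm_num⟩

/-- The Fourier transform of the test data, `e^{it₀|η|²} ⟨η⟩^{-s} φ((ξ - κ)/R)` with
`η = 2πξ`, where `φ` is the cutoff. The parameters `R` and `κ` refer to Mathlib's frequency
variable `ξ`. -/
def testSymbol (s t₀ R : ℝ) (κ : E) (ξ : E) : ℂ :=
  cexp (I * (t₀ * ‖(2 * π) • ξ‖ ^ 2 : ℝ)) *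
    (japaneseBracket ((2 * π) • ξ) ^ (-s) * cutoff d (R⁻¹ • (ξ - κ)) : ℝ)

lemma japaneseBracket_pos (x : E) : 0 < japaneseBracket x :=
  Real.sqrt_pos.2 (by positivity)

lemma norm_le_japaneseBracket (x : E) : ‖x‖ ≤ japaneseBracket x :=
  Real.le_sqrt_of_sq_le (by linarith)

lemma japaneseBracket_le (x : E) : japaneseBracket x ≤ 1 + ‖x‖ :=
  Real.sqrt_le_iff.2 ⟨by positivity, by nlinarith [norm_nonneg x]⟩

lemma contDiff_japaneseBracket_rpow (s : ℝ) :
    ContDiff ℝ ∞ fun x : E => japaneseBracket x ^ s := by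
  unfold japaneseBracket
  refine ContDiff.rpow_const_of_ne (ContDiff.sqrt (contDiff_const.add (contDiff_norm_sq ℝ))
    fun x => ?_) fun x => ?_
  · positivity
  · exact (japaneseBracket_pos x).ne'

lemma norm_sub_le_of_cutoff_ne_zero {R : ℝ} (hR : 0 < R) {κ ξ : E}
    (h : cutoff d (R⁻¹ • (ξ - κ)) ≠ 0) : ‖ξ - κ‖ ≤ R := by
  by_contra! hlt
  refine h ((cutoff d).zero_of_le_dist ?_)
  rw [dist_zero_right, norm_smul, norm_inv, norm_of_nonneg hR.le]
  change (1 : ℝ) ≤ _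
  rw [inv_mul_eq_div, le_div_iff₀ hR]
  linarith

lemma hasCompactSupport_cutoff_comp {R : ℝ} (hR : 0 < R) (κ : E) :
    HasCompactSupport fun ξ : E => cutoff d (R⁻¹ • (ξ - κ)) := by
  refine HasCompactSupport.of_support_subset_isCompact (isCompact_closedBall κ R) fun ξ hξ => ?_
  rw [mem_closedBall, dist_eq_norm]
  exact norm_sub_le_of_cutoff_ne_zero hR hξ

lemma contDiff_cutoff_comp (R : ℝ) (κ : E) :
    ContDiff ℝ ∞ fun ξ : E => cutoff d (R⁻¹ • (ξ - κ)) :=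
  (cutoff d).contDiff.comp (by fun_prop)

lemma hasCompactSupport_testSymbol (s t₀ : ℝ) {R : ℝ} (hR : 0 < R) (κ : E) :
    HasCompactSupport (testSymbol s t₀ R κ) := by
  refine (hasCompactSupport_cutoff_comp hR κ).mono fun ξ hξ => ?_
  contrapose! hξ
  simp only [Function.mem_support, ne_eq, not_not] at hξ ⊢
  simp [testSymbol, hξ]

lemma contDiff_testSymbol (s t₀ R : ℝ) (κ : E) : ContDiff ℝ ∞ (testSymbol s t₀ R κ) := by
  unfold testSymbol
  refine ContDiff.mul (ContDiff.cexp (contDiff_const.mul (ofRealCLM.contDiff.comp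
    (contDiff_const.mul ((contDiff_norm_sq ℝ).comp (by fun_prop)))))) ?_
  exact ofRealCLM.contDiff.comp
    (((contDiff_japaneseBracket_rpow (-s)).comp (by fun_prop)).mul (contDiff_cutoff_comp R κ))

/-- The Schwartz function whose Fourier transform is `testSymbol s t₀ R κ`. -/
def testData (s t₀ : ℝ) {R : ℝ} (hR : 0 < R) (κ : E) : 𝓢(E, ℂ) :=
  𝓕⁻ ((hasCompactSupport_testSymbol s t₀ hR κ).toSchwartzMap (contDiff_testSymbol s t₀ R κ))

lemma fourier_testData (s t₀ : ℝ) {R : ℝ} (hR : 0 < R) (κ : E) :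
    ⇑(𝓕 (testData s t₀ hR κ) : 𝓢(E, ℂ)) = testSymbol s t₀ R κ := by
  rw [testData, FourierTransform.fourier_fourierInv_eq]
  rfl

lemma coe_testData (s t₀ : ℝ) {R : ℝ} (hR : 0 < R) (κ : E) :
    (testData s t₀ hR κ : E → ℂ) = 𝓕⁻ (testSymbol s t₀ R κ) := by
  rw [testData, SchwartzMap.fourierInv_coe]
  rfl

/-- The operator `⟨D⟩^s` removes the weight from the test data. -/
lemma sobolevNorm_testData (s t₀ : ℝ) {R : ℝ} (hR : 0 < R) (κ : E) (r : ℝ≥0∞) :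
    sobolevNorm s r (testData s t₀ hR κ) = eLpNorm (testData 0 t₀ hR κ) r volume := by
  rw [sobolevNorm, coe_testData, fourierMult]
  simp only [fourier_testData]
  congr 2
  ext ξ
  have h : ((japaneseBracket ((2 * π) • ξ) ^ s : ℝ) : ℂ)
      * ((japaneseBracket ((2 * π) • ξ) ^ (-s) : ℝ) : ℂ) = 1 := by
    rw [← Complex.ofReal_mul, ← Real.rpow_add (japaneseBracket_pos _)]; simp
  simp only [testSymbol, neg_zero, Real.rpow_zero, one_mul, Complex.ofReal_mul]
  rw [mul_left_comm, ← mul_assoc (ofReal _), h, one_mul]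

lemma norm_testSymbol_zero_le (t₀ R : ℝ) (κ ξ : E) : ‖testSymbol 0 t₀ R κ ξ‖ ≤ 1 := by
  rw [testSymbol, norm_mul, mul_comm I, norm_exp_ofReal_mul_I, one_mul]
  simpa [abs_of_nonneg (cutoff d).nonneg] using (cutoff d).le_one

lemma testSymbol_eq_zero (s t₀ : ℝ) {R : ℝ} (hR : 0 < R) {κ ξ : E} (h : R < ‖ξ - κ‖) :
    testSymbol s t₀ R κ ξ = 0 := by
  have : cutoff d (R⁻¹ • (ξ - κ)) = 0 := by
    by_contra h'
    exact absurd (norm_sub_le_of_cutoff_ne_zero hR h') (not_le.2 h)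
  simp [testSymbol, this]

/-! ### Lower bounds for the evolution -/

/-- An oscillatory integral with nonnegative amplitude whose phase varies by at most `1` does not
cancel. -/
lemma half_integral_le_norm_integral {w θ : E → ℝ} (θ₀ : ℝ) (hw : Integrable w)
    (hw0 : ∀ ξ, 0 ≤ w ξ) (hθ : Continuous θ) (h : ∀ ξ, w ξ ≠ 0 → |θ ξ - θ₀| ≤ 1) :
    (∫ ξ, w ξ) / 2 ≤ ‖∫ ξ, cexp (θ ξ * I) * (w ξ : ℂ)‖ := by
  have hint : Integrable fun ξ => cexp ((θ ξ - θ₀ : ℝ) * I) * (w ξ : ℂ) := by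
    refine Integrable.bdd_mul (c := 1) hw.ofReal ?_ ?_
    · exact Continuous.aestronglyMeasurable (by fun_prop)
    · exact Filter.Eventually.of_forall fun ξ => by rw [norm_exp_ofReal_mul_I]
  have h1 : ∫ ξ, cexp ((θ ξ - θ₀ : ℝ) * I) * (w ξ : ℂ)
      = cexp ((-θ₀ : ℝ) * I) * ∫ ξ, cexp (θ ξ * I) * (w ξ : ℂ) := by
    rw [← integral_const_mul]
    congr 1; ext ξ
    rw [← mul_assoc, ← Complex.exp_add]
    congr 2; push_cast; ring
  calc (∫ ξ, w ξ) / 2 = ∫ ξ, w ξ / 2 := by rw [integral_div]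
    _ ≤ ∫ ξ, (cexp ((θ ξ - θ₀ : ℝ) * I) * (w ξ : ℂ)).re := by
        refine integral_mono (hw.div_const 2) hint.re fun ξ => ?_
        simp only [re_mul_ofReal, exp_ofReal_mul_I_re]
        by_cases hξ : w ξ = 0
        · simp [hξ]
        have h2 := Real.one_sub_sq_div_two_le_cos (x := θ ξ - θ₀)
        have h3 : (θ ξ - θ₀) ^ 2 ≤ 1 := by
          rw [← sq_abs]; exact pow_le_one₀ (abs_nonneg _) (h ξ hξ)
        nlinarith [hw0 ξ]
    _ = (∫ ξ, cexp ((θ ξ - θ₀ : ℝ) * I) * (w ξ : ℂ)).re := by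
        exact integral_re hint
    _ ≤ ‖∫ ξ, cexp ((θ ξ - θ₀ : ℝ) * I) * (w ξ : ℂ)‖ := re_le_norm _
    _ = _ := by rw [h1, norm_mul, norm_exp_ofReal_mul_I, one_mul]

/-- On the frequency support of the test data the phase of `U(t)f(x)` varies by at most `1` when
`t - t₀` and the distance of `x` to the classical trajectory are small. -/
lemma abs_phase_sub_le {R τ : ℝ} (hR : 0 < R) {κ ξ x : E} (hξ : ‖ξ - κ‖ ≤ R)
    (hτ : |τ| ≤ (8 * π ^ 2)⁻¹ * R⁻¹ ^ 2) (hx : ‖x - (4 * π * τ) • κ‖ ≤ (4 * π)⁻¹ * R⁻¹) :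
    |(2 * π * inner ℝ ξ x - τ * ‖(2 * π) • ξ‖ ^ 2)
      - (2 * π * inner ℝ κ x - τ * ‖(2 * π) • κ‖ ^ 2)| ≤ 1 := by
  obtain ⟨ζ, rfl⟩ : ∃ ζ, ξ = κ + ζ := ⟨ξ - κ, by abel⟩
  obtain ⟨y, rfl⟩ : ∃ y, x = y + (4 * π * τ) • κ := ⟨x - (4 * π * τ) • κ, by abel⟩
  rw [add_sub_cancel_left] at hξ
  rw [add_sub_cancel_right] at hx
  have hπ := Real.pi_pos
  have e : (2 * π * inner ℝ (κ + ζ) (y + (4 * π * τ) • κ) - τ * ‖(2 * π) • (κ + ζ)‖ ^ 2)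
      - (2 * π * inner ℝ κ (y + (4 * π * τ) • κ) - τ * ‖(2 * π) • κ‖ ^ 2)
      = 2 * π * inner ℝ ζ y - 4 * π ^ 2 * τ * ‖ζ‖ ^ 2 := by
    simp only [norm_smul, mul_pow, norm_add_sq_real, inner_add_left, inner_add_right,
      real_inner_smul_right, norm_mul, Real.norm_ofNat, norm_of_nonneg hπ.le,
      real_inner_comm κ ζ]
    ring
  rw [e]
  have h1 : |2 * π * inner ℝ ζ y| ≤ 1 / 2 := by
    rw [abs_mul, abs_of_pos (by positivity)]
    calc 2 * π * |inner ℝ ζ y| ≤ 2 * π * (R * ((4 * π)⁻¹ * R⁻¹)) := by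
          gcongr
          exact (abs_real_inner_le_norm ζ y).trans (by gcongr)
      _ = 1 / 2 := by field_simp; norm_num
  have h2 : |4 * π ^ 2 * τ * ‖ζ‖ ^ 2| ≤ 1 / 2 := by
    rw [abs_mul, abs_mul, abs_of_pos (by positivity : 0 < 4 * π ^ 2),
      abs_of_nonneg (sq_nonneg ‖ζ‖)]
    calc 4 * π ^ 2 * |τ| * ‖ζ‖ ^ 2
        ≤ 4 * π ^ 2 * ((8 * π ^ 2)⁻¹ * R⁻¹ ^ 2) * R ^ 2 := by gcongr
      _ = 1 / 2 := by field_simp; norm_num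
  linarith [abs_sub (2 * π * inner ℝ ζ y) (4 * π ^ 2 * τ * ‖ζ‖ ^ 2)]

lemma integral_cutoff_comp {R : ℝ} (hR : 0 < R) (κ : E) :
    ∫ ξ : E, cutoff d (R⁻¹ • (ξ - κ)) = R ^ d * ∫ ξ : E, cutoff d ξ := by
  rw [integral_sub_right_eq_self (fun ξ : E => cutoff d (R⁻¹ • ξ)) κ,
    Measure.integral_comp_inv_smul_of_nonneg _ _ hR.le, finrank_euclideanSpace_fin, smul_eq_mul]

/-- The evolution of the test data is large on a neighbourhood of the space-time trajectory that
starts from the focus `(t₀, 0)` with velocity `4πκ`. -/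
lemma le_norm_schrodingerProp_testData (s t₀ : ℝ) {R : ℝ} (hR : 0 < R) (κ : E) {m : ℝ}
    (hm : ∀ ξ : E, ‖ξ - κ‖ ≤ R → m ≤ japaneseBracket ((2 * π) • ξ) ^ (-s)) {t : ℝ} {x : E}
    (ht : |t - t₀| ≤ (8 * π ^ 2)⁻¹ * R⁻¹ ^ 2)
    (hx : ‖x - (4 * π * (t - t₀)) • κ‖ ≤ (4 * π)⁻¹ * R⁻¹) :
    m * R ^ d * (∫ ξ : E, cutoff d ξ) / 2 ≤ ‖schrodingerProp t (testData s t₀ hR κ) x‖ := by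
  set w : E → ℝ := fun ξ => japaneseBracket ((2 * π) • ξ) ^ (-s) * cutoff d (R⁻¹ • (ξ - κ))
  have hbc : Continuous fun ξ : E => cutoff d (R⁻¹ • (ξ - κ)) :=
    (contDiff_cutoff_comp R κ).continuous
  have hb : Integrable fun ξ : E => cutoff d (R⁻¹ • (ξ - κ)) :=
    hbc.integrable_of_hasCompactSupport (hasCompactSupport_cutoff_comp hR κ)
  have hw : Integrable w := by
    refine Continuous.integrable_of_hasCompactSupport (Continuous.mul ?_ hbc)
      (hasCompactSupport_cutoff_comp hR κ).mul_left
    exact (contDiff_japaneseBracket_rpow (-s)).continuous.comp (continuous_const_smul _)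
  have hw0 : ∀ ξ, 0 ≤ w ξ := fun ξ =>
    mul_nonneg (Real.rpow_nonneg (japaneseBracket_pos _).le _) (cutoff d).nonneg
  have h1 : m * R ^ d * (∫ ξ : E, cutoff d ξ) ≤ ∫ ξ, w ξ := by
    rw [mul_assoc, ← integral_cutoff_comp hR κ, ← integral_const_mul]
    refine integral_mono (hb.const_mul m) hw fun ξ => ?_
    by_cases hξ : cutoff d (R⁻¹ • (ξ - κ)) = 0
    · simp [w, hξ]
    · exact mul_le_mul_of_nonneg_right (hm ξ (norm_sub_le_of_cutoff_ne_zero hR hξ))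
        (cutoff d).nonneg
  have h2 := half_integral_le_norm_integral
    (θ := fun ξ => 2 * π * inner ℝ ξ x - (t - t₀) * ‖(2 * π) • ξ‖ ^ 2)
    (2 * π * inner ℝ κ x - (t - t₀) * ‖(2 * π) • κ‖ ^ 2) hw hw0 (by fun_prop) fun ξ hξ =>
      abs_phase_sub_le hR (norm_sub_le_of_cutoff_ne_zero hR (right_ne_zero_of_mul hξ)) ht hx
  have h3 : schrodingerProp t (testData s t₀ hR κ) x
      = ∫ ξ, cexp ((2 * π * inner ℝ ξ x - (t - t₀) * ‖(2 * π) • ξ‖ ^ 2 : ℝ) * I) * (w ξ : ℂ) := by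
    rw [schrodingerProp, fourierMult, Real.fourierInv_eq']
    refine integral_congr_ae (Filter.Eventually.of_forall fun ξ => ?_)
    simp only [fourier_testData, testSymbol, smul_eq_mul, w]
    rw [← mul_assoc (cexp _) (cexp _), ← Complex.exp_add, ← mul_assoc, ← Complex.exp_add]
    congr 2
    push_cast
    ring
  rw [h3]
  linarith

lemma volume_closedBall_eq (x : E) {ρ : ℝ} (hρ : 0 ≤ ρ) :
    volume (closedBall x ρ) = ENNReal.ofReal (ρ ^ d * volume.real (ball (0 : E) 1)) := by
  rw [Measure.addHaar_closedBall _ _ hρ, finrank_euclideanSpace_fin,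
    ENNReal.ofReal_mul (by positivity), ofReal_measureReal]

lemma measureReal_ball_pos : 0 < volume.real (ball (0 : E) 1) :=
  ENNReal.toReal_pos (measure_ball_pos _ _ one_pos).ne' measure_ball_lt_top.ne

lemma integral_cutoff_pos : 0 < ∫ ξ : E, cutoff d ξ := (cutoff d).integral_pos

/-- The `L^a`-size of the ball of radius `(4πR)⁻¹`, as a power of `R`. -/
lemma ball_volume_rpow {R : ℝ} (hR : 0 < R) (a : ℝ) :
    (((4 * π)⁻¹ * R⁻¹) ^ d * volume.real (ball (0 : E) 1)) ^ a
      = ((4 * π)⁻¹ ^ d * volume.real (ball (0 : E) 1)) ^ a * R ^ (-(d * a)) := by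
  have hv := measureReal_ball_pos (d := d)
  rw [mul_pow, mul_right_comm, Real.mul_rpow (by positivity) (by positivity)]
  congr 1
  rw [inv_pow, Real.inv_rpow (by positivity), ← Real.rpow_natCast, ← Real.rpow_mul hR.le,
    Real.rpow_neg hR.le]

lemma exists_le_eLpNorm_eLpNorm (d : ℕ) {p q : ℝ≥0∞} (hp : p ≠ 0) (hq : q ≠ 0) :
    ∃ c : ℝ, 0 < c ∧ ∀ (s t₀ R : ℝ) (hR : 0 < R) (κ : EuclideanSpace ℝ (Fin d)) (m δ : ℝ)
      (I : Set ℝ), 0 ≤ m → 0 < δ → δ ≤ (8 * π ^ 2)⁻¹ * R⁻¹ ^ 2 → Icc (t₀ - δ) (t₀ + δ) ⊆ I →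
      (∀ ξ : EuclideanSpace ℝ (Fin d), ‖ξ - κ‖ ≤ R →
        m ≤ japaneseBracket ((2 * π) • ξ) ^ (-s)) →
      ENNReal.ofReal (c * (m * R ^ d * R ^ (-(d * (q⁻¹).toReal)) * δ ^ (p⁻¹).toReal))
        ≤ eLpNorm (fun t => eLpNorm (schrodingerProp t (testData s t₀ hR κ)) q volume) p
          (volume.restrict I) := by
  have hv := measureReal_ball_pos (d := d)
  have hc := integral_cutoff_pos (d := d)
  refine ⟨(∫ ξ, cutoff d ξ) / 2
    * ((4 * π)⁻¹ ^ d * volume.real (ball (0 : EuclideanSpace ℝ (Fin d)) 1)) ^ (q⁻¹).toReal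
    * 2 ^ (p⁻¹).toReal, by positivity, fun s t₀ R hR κ m δ I hm0 hδ hδR hI hm => ?_⟩
  have hpt : ∀ t ∈ Icc (t₀ - δ) (t₀ + δ),
      ENNReal.ofReal (m * R ^ d * (∫ ξ, cutoff d ξ) / 2)
        * volume (closedBall ((4 * π * (t - t₀)) • κ) ((4 * π)⁻¹ * R⁻¹)) ^ (q⁻¹).toReal
        ≤ ‖eLpNorm (schrodingerProp t (testData s t₀ hR κ)) q volume‖ₑ := by
    intro t ht
    refine mul_measure_rpow_le_eLpNorm hq isClosed_closedBall.measurableSet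
      (measure_closedBall_pos _ _ (by positivity)).ne' fun x hx => ?_
    rw [← ofReal_norm]
    refine ENNReal.ofReal_le_ofReal (le_norm_schrodingerProp_testData s t₀ hR κ hm ?_ ?_)
    · refine le_trans ?_ hδR
      rw [abs_le]; constructor <;> linarith [ht.1, ht.2]
    · rwa [mem_closedBall, dist_eq_norm] at hx
  have hIm : volume.restrict I (Icc (t₀ - δ) (t₀ + δ)) = ENNReal.ofReal (2 * δ) := by
    rw [Measure.restrict_eq_self _ hI, Real.volume_Icc]; ring_nf
  simp only [volume_closedBall_eq _ (by positivity : 0 ≤ (4 * π)⁻¹ * R⁻¹)] at hpt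
  refine le_trans (le_of_eq ?_) (mul_measure_rpow_le_eLpNorm hp measurableSet_Icc
    (by rw [hIm]; simpa using hδ) hpt)
  rw [hIm, ENNReal.ofReal_rpow_of_pos (by positivity), ENNReal.ofReal_rpow_of_pos (by positivity),
    ← ENNReal.ofReal_mul (by positivity), ← ENNReal.ofReal_mul (by positivity),
    ball_volume_rpow hR, Real.mul_rpow (by norm_num) hδ.le]
  ring_nf

lemma exists_le_eLpNorm_prod (d : ℕ) {p : ℝ≥0∞} (hp : p ≠ 0) :
    ∃ c : ℝ, 0 < c ∧ ∀ (R : ℝ) (hR : 0 < R) (κ : EuclideanSpace ℝ (Fin d)), 1 ≤ R →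
      ENNReal.ofReal (c * R ^ ((d : ℝ) - (d + 2) * (p⁻¹).toReal))
        ≤ eLpNorm (fun z : ℝ × EuclideanSpace ℝ (Fin d) =>
            schrodingerProp z.1 (testData 0 0 hR κ) z.2) p
          (volume.restrict (Icc (-1 : ℝ) 1 ×ˢ univ)) := by
  have hv := measureReal_ball_pos (d := d)
  have hc := integral_cutoff_pos (d := d)
  refine ⟨(∫ ξ, cutoff d ξ) / 2
    * ((4 * π)⁻¹ ^ d * volume.real (ball (0 : EuclideanSpace ℝ (Fin d)) 1)) ^ (p⁻¹).toReal
    * (2 * (8 * π ^ 2)⁻¹) ^ (p⁻¹).toReal, by positivity, fun R hR κ hR1 => ?_⟩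
  set δ : ℝ := (8 * π ^ 2)⁻¹ * R⁻¹ ^ 2 with hδ
  have hδ0 : 0 < δ := by positivity
  -- The neighbourhood of the trajectory `x = 4π t κ` on which there is no cancellation.
  set A : Set (ℝ × EuclideanSpace ℝ (Fin d)) :=
    {z | |z.1| ≤ δ ∧ ‖z.2 - (4 * π * z.1) • κ‖ ≤ (4 * π)⁻¹ * R⁻¹} with hA
  have hAm : MeasurableSet A := by
    have h1 : Continuous fun z : ℝ × EuclideanSpace ℝ (Fin d) => |z.1| := by fun_prop
    have h2 : Continuous fun z : ℝ × EuclideanSpace ℝ (Fin d) =>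
        ‖z.2 - (4 * π * z.1) • κ‖ := by fun_prop
    exact ((isClosed_le h1 continuous_const).inter
      (isClosed_le h2 continuous_const)).measurableSet
  have hδ1 : δ ≤ 1 := by
    have h1 : (8 * π ^ 2)⁻¹ ≤ 1 := inv_le_one_of_one_le₀ (by nlinarith [Real.pi_gt_three])
    have h2 : R⁻¹ ^ 2 ≤ 1 := pow_le_one₀ (by positivity) (inv_le_one_of_one_le₀ hR1)
    exact mul_le_one₀ h1 (by positivity) h2
  have hAv : volume.restrict (Icc (-1 : ℝ) 1 ×ˢ univ) A = ENNReal.ofReal (2 * δ)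
      * ENNReal.ofReal (((4 * π)⁻¹ * R⁻¹) ^ d
        * volume.real (ball (0 : EuclideanSpace ℝ (Fin d)) 1)) := by
    rw [Measure.restrict_eq_self, Measure.volume_eq_prod, Measure.prod_apply hAm]
    · have : ∀ t : ℝ, volume (Prod.mk t ⁻¹' A) = (Icc (-δ) δ).indicator (fun _ =>
          ENNReal.ofReal (((4 * π)⁻¹ * R⁻¹) ^ d
            * volume.real (ball (0 : EuclideanSpace ℝ (Fin d)) 1))) t := by
        intro t
        by_cases ht : t ∈ Icc (-δ) δ
        · rw [indicator_of_mem ht, ← volume_closedBall_eq ((4 * π * t) • κ) (by positivity)]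
          congr 1; ext x
          simp [hA, abs_le.2 ht, dist_eq_norm]
        · rw [indicator_of_notMem ht]
          convert measure_empty (μ := volume)
          ext x
          simp only [hA, mem_preimage, mem_ofPred_eq, mem_empty_iff_false, iff_false, not_and]
          exact fun h => absurd (abs_le.1 h) ht
      simp only [this]
      rw [lintegral_indicator_const measurableSet_Icc, Real.volume_Icc, mul_comm]
      ring_nf
    · rintro z ⟨hz, -⟩
      exact ⟨abs_le.1 (hz.trans hδ1), mem_univ _⟩
  have hpt : ∀ z ∈ A, ENNReal.ofReal (1 * R ^ d * (∫ ξ, cutoff d ξ) / 2)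
      ≤ ‖schrodingerProp z.1 (testData 0 0 hR κ) z.2‖ₑ := by
    rintro z ⟨h1, h2⟩
    rw [← ofReal_norm]
    exact ENNReal.ofReal_le_ofReal (le_norm_schrodingerProp_testData 0 0 hR κ (by simp)
      (by rwa [sub_zero]) (by rwa [sub_zero]))
  refine le_trans (le_of_eq ?_) (mul_measure_rpow_le_eLpNorm hp hAm ?_ hpt)
  · rw [hAv, ENNReal.mul_rpow_of_nonneg _ _ ENNReal.toReal_nonneg,
      ENNReal.ofReal_rpow_of_pos (by positivity), ENNReal.ofReal_rpow_of_pos (by positivity),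
      ← ENNReal.ofReal_mul (by positivity), ← ENNReal.ofReal_mul (by positivity),
      ball_volume_rpow hR]
    have e1 : R⁻¹ ^ 2 = R ^ (-2 : ℝ) := by
      rw [Real.rpow_neg hR.le, inv_pow]; norm_cast
    have e2 : (2 * δ) ^ (p⁻¹).toReal
        = (2 * (8 * π ^ 2)⁻¹) ^ (p⁻¹).toReal * R ^ (-2 * (p⁻¹).toReal) := by
      rw [hδ, ← mul_assoc, Real.mul_rpow (by positivity) (by positivity), e1,
        ← Real.rpow_mul hR.le]
    have e3 : R ^ ((d : ℝ) - (d + 2) * (p⁻¹).toReal)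
        = R ^ d * R ^ (-(d * (p⁻¹).toReal)) * R ^ (-2 * (p⁻¹).toReal) := by
      rw [← Real.rpow_natCast, ← Real.rpow_add hR, ← Real.rpow_add hR]
      ring_nf
    rw [e2, e3]
    ring_nf
  · rw [hAv]
    refine mul_ne_zero ?_ ?_
    · simpa using hδ0
    · rw [ne_eq, ENNReal.ofReal_eq_zero, not_le]; positivity

/-! ### Upper bounds for functions with compactly supported Fourier transform -/

lemma eLpNorm_two_fourierInv (g : 𝓢(E, ℂ)) :
    eLpNorm (𝓕⁻ (g : E → ℂ)) 2 volume = eLpNorm g 2 volume := by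
  have h := SchwartzMap.norm_fourier_toL2_eq (𝓕⁻ g)
  rw [FourierTransform.fourier_fourierInv_eq] at h
  simp only [SchwartzMap.norm_toLp] at h
  have h' := (ENNReal.toReal_eq_toReal_iff' (SchwartzMap.eLpNorm_lt_top g 2 volume).ne
    (SchwartzMap.eLpNorm_lt_top (𝓕⁻ g) 2 volume).ne).1 h
  rw [h', SchwartzMap.fourierInv_coe]

section bounded

variable {g : 𝓢(EuclideanSpace ℝ (Fin d), ℂ)} {M ρ : ℝ} {y : EuclideanSpace ℝ (Fin d)}

lemma eLpNorm_le_of_bounded_of_support (hM : ∀ ξ, ‖g ξ‖ ≤ M)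
    (hg : ∀ ξ, ρ < ‖ξ - y‖ → g ξ = 0) (p : ℝ≥0∞) :
    eLpNorm g p volume ≤ ENNReal.ofReal M * volume (closedBall y ρ) ^ (p⁻¹).toReal := by
  refine eLpNorm_le_mul_measure_rpow p (fun ξ _ => ?_) fun ξ hξ => ?_
  · rw [← ofReal_norm]; exact ENNReal.ofReal_le_ofReal (hM ξ)
  · rw [mem_closedBall, dist_eq_norm, not_le] at hξ
    simp [hg ξ hξ]

lemma eLpNorm_two_fourierInv_le (hM : ∀ ξ, ‖g ξ‖ ≤ M) (hg : ∀ ξ, ρ < ‖ξ - y‖ → g ξ = 0) :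
    eLpNorm (𝓕⁻ (g : E → ℂ)) 2 volume
      ≤ ENNReal.ofReal M * volume (closedBall y ρ) ^ (1 / 2 : ℝ) := by
  rw [eLpNorm_two_fourierInv]
  simpa using eLpNorm_le_of_bounded_of_support hM hg 2

lemma enorm_fourierInv_le (hM : ∀ ξ, ‖g ξ‖ ≤ M) (hg : ∀ ξ, ρ < ‖ξ - y‖ → g ξ = 0) (x : E) :
    ‖𝓕⁻ (g : E → ℂ) x‖ₑ ≤ ENNReal.ofReal M * volume (closedBall y ρ) := by
  rw [Real.fourierInv_eq']
  refine (enorm_integral_le_lintegral_enorm _).trans ?_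
  have h := eLpNorm_le_of_bounded_of_support hM hg 1
  rw [eLpNorm_one_eq_lintegral_enorm] at h
  simp only [inv_one, ENNReal.toReal_one, ENNReal.rpow_one] at h
  refine le_trans (le_of_eq ?_) h
  congr 1; ext ξ
  rw [enorm_smul, ← ofReal_norm (cexp _), norm_exp_ofReal_mul_I]
  simp

end bounded

/-! ### Scaling, and norms of the test data -/

lemma testData_apply (s t₀ : ℝ) {R : ℝ} (hR : 0 < R) (κ x : E) :
    testData s t₀ hR κ x
      = ∫ ξ : E, cexp ((2 * π * inner ℝ ξ x : ℝ) * I) * testSymbol s t₀ R κ ξ := by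
  rw [coe_testData, Real.fourierInv_eq']
  rfl

lemma testData_eq_scaled (t₀ : ℝ) {R : ℝ} (hR : 0 < R) (x : E) :
    testData 0 t₀ hR (0 : E) x
      = (R ^ d : ℝ) * testData 0 (R ^ 2 * t₀) one_pos (0 : E) (R • x) := by
  have h := Measure.integral_comp_inv_smul_of_nonneg (volume : Measure E)
    (fun ζ : E => cexp ((2 * π * inner ℝ ζ (R • x) : ℝ) * I)
      * testSymbol 0 (R ^ 2 * t₀) 1 (0 : E) ζ) hR.le
  rw [finrank_euclideanSpace_fin, real_smul] at h
  rw [testData_apply, testData_apply, ← h]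
  congr 1; ext ξ
  simp only [testSymbol, real_inner_smul_left, real_inner_smul_right, norm_smul, inv_one,
    one_smul, sub_zero, mul_pow, norm_inv, Real.norm_of_nonneg hR.le]
  congr 4
  · field_simp
  · field_simp
  · simp

lemma norm_testData_eq (κ x : E) :
    ‖testData 0 0 one_pos κ x‖ = ‖testData 0 0 one_pos (0 : E) x‖ := by
  have h := integral_sub_right_eq_self (μ := (volume : Measure E))
    (fun ζ : E => cexp ((2 * π * inner ℝ ζ x : ℝ) * I) * testSymbol 0 0 1 (0 : E) ζ) κ
  rw [testData_apply, testData_apply, ← h]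
  have h1 : ∀ ξ : E, cexp ((2 * π * inner ℝ ξ x : ℝ) * I) * testSymbol 0 0 1 κ ξ
      = cexp ((2 * π * inner ℝ κ x : ℝ) * I) * (cexp ((2 * π * inner ℝ (ξ - κ) x : ℝ) * I)
        * testSymbol 0 0 1 (0 : E) (ξ - κ)) := by
    intro ξ
    rw [← mul_assoc, ← Complex.exp_add]
    simp only [testSymbol, inner_sub_left, neg_zero, Real.rpow_zero, sub_zero, zero_mul]
    congr 2
    push_cast; ring
  simp only [h1]
  rw [integral_const_mul, norm_mul, norm_exp_ofReal_mul_I, one_mul]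

lemma eLpNorm_testData_translate (κ : E) (r : ℝ≥0∞) :
    eLpNorm (testData 0 0 one_pos κ) r volume
      = eLpNorm (testData 0 0 one_pos (0 : E)) r volume :=
  eLpNorm_congr_norm_ae (Filter.Eventually.of_forall fun x => norm_testData_eq κ x)

lemma eLpNorm_testData_scaled {R : ℝ} (hR : 0 < R) (r : ℝ≥0∞) :
    eLpNorm (testData 0 0 hR (0 : E)) r volume
      = ENNReal.ofReal (R ^ ((d : ℝ) - d * (r⁻¹).toReal))
        * eLpNorm (testData 0 0 one_pos (0 : E)) r volume := by
  have h : (testData 0 0 hR (0 : E) : E → ℂ)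
      = ((R ^ d : ℝ) : ℂ) • fun x => testData 0 0 one_pos (0 : E) (R • x) := by
    ext x
    rw [testData_eq_scaled, mul_zero]; rfl
  rw [h, eLpNorm_const_smul, eLpNorm_comp_smul _ (SchwartzMap.continuous _) hR, ← mul_assoc,
    ← ofReal_norm, ← ENNReal.ofReal_mul (by positivity), norm_real,
    Real.norm_of_nonneg (by positivity), sub_eq_add_neg, Real.rpow_add hR, Real.rpow_natCast]

/-- The dispersive estimate, for the evolution regularized by a Gaussian. -/
lemma norm_integral_fourier_mul_gaussian_le (Ψ : 𝓢(E, ℂ)) {b : ℂ} (hb : 0 < b.re) (x : E) :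
    ‖∫ ζ : E, (𝓕 (Ψ : E → ℂ)) ζ * cexp (-b * ‖ζ‖ ^ 2 + 2 * π * I * inner ℝ x ζ)‖
      ≤ (π / ‖b‖) ^ (d / 2 : ℝ) * ∫ y, ‖Ψ y‖ := by
  have hint := GaussianFourier.integrable_cexp_neg_mul_sq_norm_add hb (2 * π * I) x
  have h := VectorFourier.integral_fourierIntegral_smul_eq_flip (μ := (volume : Measure E))
    (ν := (volume : Measure E)) (L := innerₗ E)
    Real.continuous_fourierChar continuous_inner Ψ.integrable hint
  rw [flip_innerₗ] at h
  have h' : ∫ ζ : E, (𝓕 (Ψ : E → ℂ)) ζ * cexp (-b * ‖ζ‖ ^ 2 + 2 * π * I * inner ℝ x ζ)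
      = ∫ y : E, Ψ y * 𝓕 (fun ζ : E => cexp (-b * ‖ζ‖ ^ 2 + 2 * π * I * inner ℝ x ζ)) y := h
  rw [h', ← integral_const_mul]
  refine norm_integral_le_of_norm_le (Ψ.integrable.norm.const_mul _)
    (Filter.Eventually.of_forall fun y => ?_)
  rw [norm_mul, fourier_gaussian_innerProductSpace' hb, norm_mul, mul_comm]
  refine mul_le_mul_of_nonneg_right ?_ (norm_nonneg _)
  have e1 : ‖(π / b : ℂ) ^ (Module.finrank ℝ E / 2 : ℂ)‖ = (π / ‖b‖) ^ (d / 2 : ℝ) := by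
    rw [finrank_euclideanSpace_fin, show ((d : ℂ) / 2) = ((d / 2 : ℝ) : ℂ) by push_cast; rfl,
      norm_cpow_real, norm_div, norm_real, Real.norm_of_nonneg Real.pi_pos.le]
  have e2 : ‖cexp (-π ^ 2 * ‖x - y‖ ^ 2 / b)‖ ≤ 1 := by
    rw [Complex.norm_exp, Real.exp_le_one_iff]
    have : (-π ^ 2 * ‖x - y‖ ^ 2 / b : ℂ) = ((-(π ^ 2 * ‖x - y‖ ^ 2) : ℝ) : ℂ) * b⁻¹ := by
      push_cast; ring
    rw [this, re_ofReal_mul, inv_re]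
    have : 0 ≤ b.re / normSq b := div_nonneg hb.le (normSq_nonneg b)
    nlinarith [mul_nonneg (by positivity : 0 ≤ π ^ 2 * ‖x - y‖ ^ 2) this]
  rw [e1]
  exact mul_le_of_le_one_right (by positivity) e2

lemma exists_norm_testData_le (d : ℕ) :
    ∃ C : ℝ, 0 < C ∧ ∀ (T : ℝ), 0 < T → ∀ x : EuclideanSpace ℝ (Fin d),
      ‖testData 0 T one_pos (0 : EuclideanSpace ℝ (Fin d)) x‖ ≤ C * T⁻¹ ^ (d / 2 : ℝ) := by
  -- The cutoff is divided by a Gaussian, which then regularizes the oscillating factor.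
  set ψ : EuclideanSpace ℝ (Fin d) → ℂ :=
    fun ξ => testSymbol 0 0 1 (0 : EuclideanSpace ℝ (Fin d)) ξ * cexp ((‖ξ‖ ^ 2 : ℝ)) with hψ
  have hψs : HasCompactSupport ψ := (hasCompactSupport_testSymbol 0 0 one_pos 0).mul_right
  have hψc : ContDiff ℝ ∞ ψ := (contDiff_testSymbol 0 0 1 0).mul
    (ContDiff.cexp (ofRealCLM.contDiff.comp (contDiff_norm_sq ℝ)))
  set Ψ : 𝓢(EuclideanSpace ℝ (Fin d), ℂ) := 𝓕⁻ (hψs.toSchwartzMap hψc) with hΨ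
  have hΨf : 𝓕 (Ψ : EuclideanSpace ℝ (Fin d) → ℂ) = ψ := by
    rw [← SchwartzMap.fourier_coe, hΨ, FourierTransform.fourier_fourierInv_eq]; rfl
  have hI : 0 ≤ ∫ y, ‖Ψ y‖ := integral_nonneg fun y => norm_nonneg _
  refine ⟨(∫ y, ‖Ψ y‖) + 1, by positivity, fun T hT x => ?_⟩
  set b : ℂ := 1 - (4 * π ^ 2 * T : ℝ) * I with hb
  have hbre : b.re = 1 := by
    rw [hb, sub_re, re_ofReal_mul]; simp
  have hbim : b.im = -(4 * π ^ 2 * T) := by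
    rw [hb, sub_im, im_ofReal_mul]; simp
  have h1 : testData 0 T one_pos (0 : EuclideanSpace ℝ (Fin d)) x
      = ∫ ζ, (𝓕 (Ψ : EuclideanSpace ℝ (Fin d) → ℂ)) ζ
        * cexp (-b * ‖ζ‖ ^ 2 + 2 * π * I * inner ℝ x ζ) := by
    rw [testData_apply]
    congr 1; ext ξ
    rw [hΨf, hψ]
    simp only [testSymbol, zero_mul, ofReal_zero, mul_zero, Complex.exp_zero, one_mul]
    rw [← mul_assoc, ← Complex.exp_add, mul_assoc _ (cexp _) (cexp _), ← Complex.exp_add, mul_comm]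
    congr 2
    rw [norm_smul, real_inner_comm, Real.norm_of_nonneg (by positivity), hb]
    push_cast
    ring
  have hbn : 4 * π ^ 2 * T ≤ ‖b‖ := by
    have := abs_im_le_norm b
    rwa [hbim, abs_neg, abs_of_pos (by positivity)] at this
  have hbpos : 0 < ‖b‖ := lt_of_lt_of_le (by positivity) hbn
  rw [h1]
  refine (norm_integral_fourier_mul_gaussian_le Ψ (by rw [hbre]; norm_num) x).trans ?_
  rw [mul_comm]
  have hle : π / ‖b‖ ≤ T⁻¹ := by
    rw [div_le_iff₀ hbpos, inv_mul_eq_div, le_div_iff₀ hT]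
    nlinarith [Real.pi_gt_three]
  gcongr
  linarith

/-- For data that focus at the positive time `1/2`, the initial value at frequency scale `R` has
size `1` on a ball of radius comparable to `R`. -/
lemma exists_eLpNorm_testData_half_le (d : ℕ) {r : ℝ≥0∞} (hr : 2 ≤ r) :
    ∃ C : ℝ, 0 < C ∧ ∀ (R : ℝ) (hR : 0 < R),
      eLpNorm (testData 0 (1 / 2) hR (0 : EuclideanSpace ℝ (Fin d))) r volume
        ≤ ENNReal.ofReal (C * R ^ (d * (r⁻¹).toReal)) := by
  obtain ⟨C, hC, h⟩ := exists_norm_testData_le d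
  have hv := measureReal_ball_pos (d := d)
  set v := volume.real (ball (0 : EuclideanSpace ℝ (Fin d)) 1)
  set A : ℝ := C * 2 ^ (d / 2 : ℝ) with hA
  have hA0 : 0 < A := by positivity
  refine ⟨A ^ (1 - 2 * (r⁻¹).toReal) * v ^ (r⁻¹).toReal, by positivity, fun R hR => ?_⟩
  have hsup : ∀ x, ‖testData 0 (1 / 2) hR (0 : EuclideanSpace ℝ (Fin d)) x‖ₑ
      ≤ ENNReal.ofReal A := by
    intro x
    rw [← ofReal_norm]
    refine ENNReal.ofReal_le_ofReal ?_
    rw [testData_eq_scaled, norm_mul, norm_real, Real.norm_of_nonneg (by positivity)]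
    calc _ ≤ R ^ d * (C * (R ^ 2 * (1 / 2))⁻¹ ^ (d / 2 : ℝ)) := by
          gcongr; exact h _ (by positivity) _
      _ = A := by
          have : (R ^ 2 * (1 / 2))⁻¹ = (R ^ 2)⁻¹ * 2 := by field_simp
          rw [this, Real.mul_rpow (by positivity) (by norm_num), Real.inv_rpow (by positivity),
            ← Real.rpow_natCast R 2, ← Real.rpow_mul hR.le, ← Real.rpow_natCast R d, hA]
          have : ((2 : ℕ) : ℝ) * (d / 2) = d := by push_cast; ring
          rw [this]
          have : R ^ (d : ℝ) ≠ 0 := by positivity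
          field_simp
  have h2 : eLpNorm (testData 0 (1 / 2) hR (0 : EuclideanSpace ℝ (Fin d))) 2 volume
      ≤ ENNReal.ofReal ((R ^ d * v) ^ (1 / 2 : ℝ)) := by
    rw [testData, SchwartzMap.fourierInv_coe]
    refine (eLpNorm_two_fourierInv_le (M := 1) (ρ := R) (y := 0)
      (norm_testSymbol_zero_le _ R 0) fun ξ => testSymbol_eq_zero 0 _ hR).trans (le_of_eq ?_)
    rw [volume_closedBall_eq _ hR.le, ENNReal.ofReal_one, one_mul,
      ENNReal.ofReal_rpow_of_pos (by positivity)]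
  refine (eLpNorm_le_rpow_mul_rpow hr hsup ENNReal.ofReal_ne_top h2).trans (le_of_eq ?_)
  rw [ENNReal.ofReal_rpow_of_pos hA0, ENNReal.ofReal_rpow_of_pos (by positivity),
    ← ENNReal.ofReal_mul (by positivity), ← Real.rpow_mul (by positivity),
    show 1 / 2 * (2 * (r⁻¹).toReal) = (r⁻¹).toReal by ring,
    Real.mul_rpow (by positivity) hv.le, ← Real.rpow_natCast, ← Real.rpow_mul hR.le]
  congr 1
  ring

/-! ### The modulation norm of the test data -/

/-- The symbol of `□_k f` for the test data `f`. -/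
def boxSymbol (σ : E → ℂ) (k : Fin d → ℤ) (R : ℝ) (κ ξ : E) : ℂ :=
  σ ((2 * π) • ξ - latticePoint k) * testSymbol 0 0 R κ ξ

lemma boxOp_testData (σ : E → ℂ) (k : Fin d → ℤ) {R : ℝ} (hR : 0 < R) (κ : E) :
    boxOp σ k (testData 0 0 hR κ) = 𝓕⁻ (boxSymbol σ k R κ) := by
  rw [boxOp, fourierMult]
  simp only [fourier_testData]
  rfl

lemma boxSymbol_eq_zero {σ : E → ℂ} {ρ : ℝ} (hρ : ∀ η, ρ < ‖η‖ → σ η = 0) (k : Fin d → ℤ)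
    {R : ℝ} (κ : E) {ξ : E} (h : ρ / (2 * π) < ‖ξ - (2 * π)⁻¹ • latticePoint k‖) :
    boxSymbol σ k R κ ξ = 0 := by
  have hπ : 0 < 2 * π := by positivity
  have : (2 * π) • ξ - latticePoint k = (2 * π) • (ξ - (2 * π)⁻¹ • latticePoint k) := by
    rw [smul_sub, smul_inv_smul₀ hπ.ne']
  rw [boxSymbol, this, hρ, zero_mul]
  rw [norm_smul, Real.norm_of_nonneg hπ.le]
  rwa [div_lt_iff₀' hπ] at h

lemma boxOp_testData_eq_zero {σ : E → ℂ} {ρ : ℝ} (hρ : ∀ η, ρ < ‖η‖ → σ η = 0) (k : Fin d → ℤ)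
    {R : ℝ} (hR : 0 < R) (κ : E) (h : 2 * π * R + ρ < ‖latticePoint k - (2 * π) • κ‖) :
    boxOp σ k (testData 0 0 hR κ) = 0 := by
  have hz : boxSymbol σ k R κ = 0 := by
    ext ξ
    by_cases hξ : R < ‖ξ - κ‖
    · simp [boxSymbol, testSymbol_eq_zero 0 0 hR hξ]
    · rw [boxSymbol, hρ, zero_mul, Pi.zero_apply]
      have h1 : latticePoint k - (2 * π) • κ
          = (2 * π) • (ξ - κ) - ((2 * π) • ξ - latticePoint k) := by
        rw [smul_sub]; abel
      have h2 := norm_sub_le ((2 * π) • (ξ - κ)) ((2 * π) • ξ - latticePoint k)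
      rw [← h1, norm_smul, Real.norm_of_nonneg (by positivity)] at h2
      have h3 : 2 * π * ‖ξ - κ‖ ≤ 2 * π * R := by
        rw [not_lt] at hξ; gcongr
      linarith
  rw [boxOp_testData, hz]
  ext x
  simp [Real.fourierInv_eq']

/-- The pieces `□_k f` of the test data are bounded in `L^p`, uniformly in `k` and in the frequency
scale. -/
lemma exists_eLpNorm_boxOp_le {σ : E → ℂ} (hσ : IsUniformPartition σ) {p : ℝ≥0∞} (hp : 2 ≤ p) :
    ∃ K : ℝ, 0 ≤ K ∧ ∀ (k : Fin d → ℤ) (R : ℝ) (hR : 0 < R) (κ : E),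
      eLpNorm (boxOp σ k (testData 0 0 hR κ)) p volume ≤ ENNReal.ofReal K := by
  obtain ⟨M, hM⟩ := hσ.hasCompactSupport.exists_bound_of_continuous hσ.smooth.continuous
  obtain ⟨ρ, hρ0, hρ⟩ := hσ.hasCompactSupport.exists_pos_le_norm
  have hρ' : ∀ η, ρ < ‖η‖ → σ η = 0 := fun η h => hρ η h.le
  have hM0 : 0 ≤ M := (norm_nonneg _).trans (hM 0)
  set V : ℝ≥0∞ := volume (closedBall (0 : E) (ρ / (2 * π)))
  have hV : V ≠ ⊤ := measure_closedBall_lt_top.ne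
  set B : ℝ≥0∞ := (ENNReal.ofReal M * V) ^ (1 - 2 * (p⁻¹).toReal)
      * (ENNReal.ofReal M * V ^ (1 / 2 : ℝ)) ^ (2 * (p⁻¹).toReal) with hB
  have hfin : B ≠ ⊤ := by
    have hp2 : (p⁻¹).toReal ≤ 1 / 2 := by
      have := ENNReal.toReal_mono (by simp) (ENNReal.inv_le_inv.2 hp)
      simpa using this
    refine ENNReal.mul_ne_top (ENNReal.rpow_ne_top_of_nonneg (by linarith)
      (ENNReal.mul_ne_top ENNReal.ofReal_ne_top hV)) (ENNReal.rpow_ne_top_of_nonneg (by positivity)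
      (ENNReal.mul_ne_top ENNReal.ofReal_ne_top
        (ENNReal.rpow_ne_top_of_nonneg (by norm_num) hV)))
  refine ⟨B.toReal, ENNReal.toReal_nonneg, fun k R hR κ => ?_⟩
  rw [ENNReal.ofReal_toReal hfin, hB]
  have hc : HasCompactSupport (boxSymbol σ k R κ) :=
    (hasCompactSupport_testSymbol 0 0 hR κ).mul_left
  have hs : ContDiff ℝ ∞ (boxSymbol σ k R κ) :=
    (hσ.smooth.comp (by fun_prop)).mul (contDiff_testSymbol 0 0 R κ)
  set g : 𝓢(E, ℂ) := hc.toSchwartzMap hs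
  have hgc : boxSymbol σ k R κ = g := rfl
  have hgb : ∀ ξ, ‖g ξ‖ ≤ M := fun ξ => by
    change ‖boxSymbol σ k R κ ξ‖ ≤ M
    rw [boxSymbol, norm_mul]
    calc _ ≤ M * 1 := mul_le_mul (hM _) (norm_testSymbol_zero_le 0 R κ ξ) (norm_nonneg _) hM0
      _ = M := mul_one M
  have hg0 : ∀ ξ, ρ / (2 * π) < ‖ξ - (2 * π)⁻¹ • latticePoint k‖ → g ξ = 0 :=
    fun ξ hξ => boxSymbol_eq_zero hρ' k κ hξ
  have hVk : volume (closedBall ((2 * π)⁻¹ • latticePoint k : E) (ρ / (2 * π))) = V :=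
    Measure.addHaar_closedBall_center _ _ _
  rw [boxOp_testData, hgc]
  refine eLpNorm_le_rpow_mul_rpow hp (fun x => ?_)
    (ENNReal.mul_ne_top ENNReal.ofReal_ne_top hV) ?_
  · rw [← hVk]; exact enorm_fourierInv_le hgb hg0 x
  · rw [← hVk]; exact eLpNorm_two_fourierInv_le hgb hg0

lemma count_latticePoint_le (y : E) {T : ℝ} (hT : 0 ≤ T) :
    Measure.count {k : Fin d → ℤ | ‖latticePoint k - y‖ ≤ T}
      ≤ ENNReal.ofReal ((2 * T + 1) ^ d) := by
  have hsub : {k : Fin d → ℤ | ‖latticePoint k - y‖ ≤ T}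
      ⊆ ↑(Fintype.piFinset fun i => Finset.Icc ⌈y i - T⌉ ⌊y i + T⌋) := by
    intro k hk
    simp only [Fintype.coe_piFinset, Finset.coe_Icc, mem_pi, mem_univ, forall_const, mem_Icc,
      Int.ceil_le, Int.le_floor]
    intro i
    have h1 : |(k i : ℝ) - y i| ≤ T := (PiLp.norm_apply_le (latticePoint k - y) i).trans hk
    rw [abs_le] at h1
    constructor <;> linarith [h1.1, h1.2]
  refine (measure_mono hsub).trans ?_
  rw [Measure.count_apply_finset, Fintype.card_piFinset, ← ENNReal.ofReal_natCast]
  refine ENNReal.ofReal_le_ofReal ?_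
  push_cast
  calc ∏ i, ((Finset.Icc ⌈y i - T⌉ ⌊y i + T⌋).card : ℝ) ≤ ∏ _i : Fin d, (2 * T + 1) := by
        refine Finset.prod_le_prod (fun i _ => by positivity) fun i _ => ?_
        rw [Int.card_Icc]
        have h1 := Int.le_ceil (y i - T)
        have h2 := Int.floor_le (y i + T)
        have h3 : (((⌊y i + T⌋ + 1 - ⌈y i - T⌉).toNat : ℤ) : ℝ)
            = max ((⌊y i + T⌋ : ℝ) + 1 - ⌈y i - T⌉) 0 := by
          rw [Int.toNat_eq_max]; push_cast; rfl
        rw [← Int.cast_natCast, h3]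
        exact max_le (by linarith) (by linarith)
    _ = (2 * T + 1) ^ d := by simp

lemma exists_modulationNorm_testData_le {σ : E → ℂ} (hσ : IsUniformPartition σ) {p : ℝ≥0∞}
    (hp : 2 ≤ p) (q : ℝ≥0∞) :
    ∃ ρ K : ℝ, 0 < ρ ∧ 0 ≤ K ∧ ∀ (s R : ℝ) (hR : 0 < R) (κ : E) (A : ℝ), 1 ≤ R → 0 ≤ A →
      (∀ k : Fin d → ℤ, ‖latticePoint k - (2 * π) • κ‖ ≤ 2 * π * R + ρ →
        japaneseBracket (latticePoint k) ^ s ≤ A) →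
      modulationNorm σ s p q (testData 0 0 hR κ)
        ≤ ENNReal.ofReal (K * (A * R ^ (d * (q⁻¹).toReal))) := by
  obtain ⟨K, hK0, hK⟩ := exists_eLpNorm_boxOp_le hσ hp
  obtain ⟨ρ, hρ0, hρ⟩ := hσ.hasCompactSupport.exists_pos_le_norm
  have hρ' : ∀ η, ρ < ‖η‖ → σ η = 0 := fun η h => hρ η h.le
  set B : ℝ := 2 * (2 * π + ρ) + 1
  have hB0 : 0 < B := by positivity
  refine ⟨ρ, K * (B ^ d) ^ (q⁻¹).toReal, hρ0, by positivity, fun s R hR κ A hR1 hA hAk => ?_⟩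
  rw [modulationNorm]
  have hcount : Measure.count {k : Fin d → ℤ | ‖latticePoint k - (2 * π) • κ‖ ≤ 2 * π * R + ρ}
      ≤ ENNReal.ofReal ((B * R) ^ d) := by
    refine (count_latticePoint_le _ (by positivity)).trans (ENNReal.ofReal_le_ofReal ?_)
    gcongr
    simp only [B]
    nlinarith
  have hle := eLpNorm_le_mul_measure_rpow (μ := (Measure.count : Measure (Fin d → ℤ))) q
    (A := {k : Fin d → ℤ | ‖latticePoint k - (2 * π) • κ‖ ≤ 2 * π * R + ρ})
    (c := ENNReal.ofReal (A * K))
    (F := fun k : Fin d → ℤ => ENNReal.ofReal (japaneseBracket (latticePoint k) ^ s)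
      * eLpNorm (boxOp σ k (testData 0 0 hR κ)) p volume) ?_ ?_
  · refine hle.trans ?_
    calc _ ≤ ENNReal.ofReal (A * K) * ENNReal.ofReal ((B * R) ^ d) ^ (q⁻¹).toReal := by gcongr
      _ = _ := by
        rw [ENNReal.ofReal_rpow_of_pos (by positivity), ← ENNReal.ofReal_mul (by positivity),
          mul_pow, Real.mul_rpow (by positivity) (by positivity), ← Real.rpow_natCast R,
          ← Real.rpow_mul hR.le]
        ring_nf
  · intro k hk
    rw [enorm_eq_self, ENNReal.ofReal_mul hA]
    exact mul_le_mul' (ENNReal.ofReal_le_ofReal (hAk k hk)) (hK k R hR κ)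
  · intro k hk
    simp only [mem_ofPred_eq, not_le] at hk
    simp [boxOp_testData_eq_zero hρ' k hR κ hk]

/-! ### Necessary conditions -/

lemma le_mul_of_ofReal_le {C : ℝ≥0} {a b : ℝ} {X : ℝ≥0∞} (h : ENNReal.ofReal a ≤ C * X)
    (hX : X ≤ ENNReal.ofReal b) (hb : 0 ≤ b) : a ≤ C * b := by
  rw [← ENNReal.ofReal_le_ofReal_iff (by positivity), ENNReal.ofReal_mul C.coe_nonneg,
    ENNReal.ofReal_coe_nnreal]
  exact h.trans (by gcongr)

lemma exists_norm_eq_one (hd : 1 ≤ d) : ∃ e : E, ‖e‖ = 1 :=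
  ⟨EuclideanSpace.single ⟨0, hd⟩ 1, by simp⟩

lemma le_norm_of_norm_sub_smul_le {e x : E} (he : ‖e‖ = 1) {a b : ℝ} (h : ‖x - a • e‖ ≤ b) :
    a - b ≤ ‖x‖ := by
  have h1 := norm_sub_norm_le (a • e) x
  rw [norm_sub_rev, norm_smul, he, mul_one, Real.norm_eq_abs] at h1
  linarith [le_abs_self a]

section modulation

variable {σ : EuclideanSpace ℝ (Fin d) → ℂ} {s : ℝ} {p q : ℝ≥0∞}

/-- Data of fixed shape, with frequency tending to infinity. -/
lemma ModulationSmoothing.nonneg (hd : 1 ≤ d) (hσ : IsUniformPartition σ) (hp : 2 ≤ p)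
    (h : ModulationSmoothing d σ s p q) : 0 ≤ s := by
  by_contra! hs
  have hp0 : p ≠ 0 := (lt_of_lt_of_le (by norm_num) hp).ne'
  obtain ⟨C, h⟩ := h
  obtain ⟨e, he⟩ := exists_norm_eq_one hd
  obtain ⟨c, hc, hlow⟩ := exists_le_eLpNorm_prod d hp0
  obtain ⟨ρ, K, hρ, hK, hup⟩ := exists_modulationNorm_testData_le hσ hp q
  -- As `s < 0` and all contributing `k` have `|k| ≥ N`, the modulation norm is `O(N^s)`.
  refine absurd (le_of_forall_mul_rpow_le (C := C * K) (α := 0) (β := s) hc fun N hN => ?_)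
    (not_le.2 hs)
  have hN0 : 0 < N := by linarith
  have h1 := hup s 1 one_pos ((N + ρ + 2 * π) • e) (N ^ s) le_rfl (by positivity) fun k hk => by
    rw [smul_smul] at hk
    have h2 := le_norm_of_norm_sub_smul_le he hk
    refine Real.rpow_le_rpow_of_nonpos hN0 (le_trans ?_ (norm_le_japaneseBracket _)) hs.le
    refine le_trans ?_ h2
    nlinarith [Real.pi_gt_three]
  have h2 := le_mul_of_ofReal_le
    ((hlow 1 one_pos ((N + ρ + 2 * π) • e) le_rfl).trans (h _)) h1 (by positivity)
  simp only [Real.one_rpow, mul_one] at h2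
  rw [Real.rpow_zero, mul_one, mul_assoc]
  exact h2

/-- Data concentrated at a point at scale `1/N`. -/
lemma ModulationSmoothing.le (hσ : IsUniformPartition σ) (hp : 2 ≤ p) (hs : 0 ≤ s)
    (h : ModulationSmoothing d σ s p q) :
    (d : ℝ) - (d + 2) * (p⁻¹).toReal ≤ s + d * (q⁻¹).toReal := by
  have hp0 : p ≠ 0 := (lt_of_lt_of_le (by norm_num) hp).ne'
  obtain ⟨C, h⟩ := h
  obtain ⟨c, hc, hlow⟩ := exists_le_eLpNorm_prod d hp0
  obtain ⟨ρ, K, hρ, hK, hup⟩ := exists_modulationNorm_testData_le hσ hp q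
  refine le_of_forall_mul_rpow_le (C := C * K * (1 + 2 * π + ρ) ^ s) hc fun N hN => ?_
  have hN0 : 0 < N := by linarith
  have h1 := hup s N hN0 0 (((1 + 2 * π + ρ) * N) ^ s) hN (by positivity) fun k hk => by
    rw [smul_zero, sub_zero] at hk
    refine Real.rpow_le_rpow (japaneseBracket_pos _).le ((japaneseBracket_le _).trans ?_) hs
    nlinarith
  have h2 := le_mul_of_ofReal_le ((hlow N hN0 0 hN).trans (h _)) h1 (by positivity)
  refine h2.trans (le_of_eq ?_)
  rw [Real.mul_rpow (by positivity) hN0.le, Real.rpow_add hN0]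
  ring

end modulation

section strichartz

variable {I : Set ℝ} {s : ℝ} {p q r : ℝ≥0∞}

/-- Data of fixed shape, with frequency tending to infinity. -/
lemma StrichartzEstimate.nonneg (hd : 1 ≤ d) (hI : Icc (-1) 1 ⊆ I) (hp : p ≠ 0) (hq : q ≠ 0)
    (h : StrichartzEstimate d I s p q r) : 0 ≤ s := by
  by_contra! hs
  obtain ⟨C, h⟩ := h
  obtain ⟨e, he⟩ := exists_norm_eq_one hd
  obtain ⟨c, hc, hlow⟩ := exists_le_eLpNorm_eLpNorm d hp hq
  have hfin := ((testData 0 0 one_pos (0 : E)).eLpNorm_lt_top r).ne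
  set δ : ℝ := (8 * π ^ 2)⁻¹ with hδ
  have hδ0 : 0 < δ := by positivity
  have hδ1 : δ ≤ 1 := inv_le_one_of_one_le₀ (by nlinarith [Real.pi_gt_three])
  -- As `s < 0`, the weight `⟨η⟩^{-s}` is at least `N^{-s}` on the frequency support of the data.
  have := le_of_forall_mul_rpow_le (c := c * δ ^ (p⁻¹).toReal) (α := -s) (β := 0)
    (C := C * (eLpNorm (testData 0 0 one_pos (0 : E)) r volume).toReal) (by positivity)
    fun N hN => by
      have hN0 : 0 < N := by linarith
      have h1 := hlow s 0 1 one_pos ((N + 1) • e) (N ^ (-s)) δ I (by positivity) hδ0 (by simp [δ])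
        (fun t ht => hI ⟨by linarith [ht.1], by linarith [ht.2]⟩) fun ξ hξ => by
          have h2 := le_norm_of_norm_sub_smul_le he hξ
          refine Real.rpow_le_rpow hN0.le (le_trans ?_ (norm_le_japaneseBracket _)) (by linarith)
          rw [norm_smul, Real.norm_of_nonneg (by positivity)]
          nlinarith [Real.pi_gt_three, norm_nonneg ξ]
      have h2 := le_mul_of_ofReal_le (h1.trans (h _))
        (by rw [sobolevNorm_testData, eLpNorm_testData_translate, ENNReal.ofReal_toReal hfin])
        ENNReal.toReal_nonneg
      simp only [one_pow, Real.one_rpow, mul_one] at h2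
      rw [Real.rpow_zero, mul_one]
      linarith
  linarith

/-- Data at frequency scale `1/N`, which do not disperse up to times of order `N^2`. The exponent
`γ` is that of the time interval: `γ = 0` for a bounded interval and `γ = 2` for `ℝ`. -/
lemma StrichartzEstimate.low_frequency (hs : 0 ≤ s) (hp : p ≠ 0) (hq : q ≠ 0) {γ : ℝ}
    (hγ : γ ≤ 2)
    (hI : ∀ N : ℝ, 1 ≤ N → Icc (-((8 * π ^ 2)⁻¹ * N ^ γ)) ((8 * π ^ 2)⁻¹ * N ^ γ) ⊆ I)
    (h : StrichartzEstimate d I s p q r) :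
    γ * (p⁻¹).toReal + d * (q⁻¹).toReal ≤ d * (r⁻¹).toReal := by
  obtain ⟨C, h⟩ := h
  obtain ⟨c, hc, hlow⟩ := exists_le_eLpNorm_eLpNorm d hp hq
  have hfin := ((testData 0 0 one_pos (0 : E)).eLpNorm_lt_top r).ne
  set K := (eLpNorm (testData 0 0 one_pos (0 : E)) r volume).toReal with hK
  have hK0 : 0 ≤ K := ENNReal.toReal_nonneg
  set δ : ℝ := (8 * π ^ 2)⁻¹ with hδ
  have hδ0 : 0 < δ := by positivity
  set m : ℝ := (1 + 2 * π) ^ (-s) with hm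
  have hm0 : 0 < m := by positivity
  have key := le_of_forall_mul_rpow_le (c := c * m * δ ^ (p⁻¹).toReal)
    (α := -(d - d * (q⁻¹).toReal) + γ * (p⁻¹).toReal) (β := -(d - d * (r⁻¹).toReal))
    (C := C * K) (by positivity)
    fun N hN => by
      have hN0 : 0 < N := by linarith
      have hR : 0 < N⁻¹ := by positivity
      have h1 := hlow s 0 N⁻¹ hR 0 m (δ * N ^ γ) I hm0.le (by positivity)
        (by
          rw [inv_inv]
          gcongr
          exact_mod_cast Real.rpow_le_rpow_of_exponent_le hN hγ)
        (by simpa only [zero_sub, zero_add] using hI N hN) fun ξ hξ => by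
          rw [sub_zero] at hξ
          refine Real.rpow_le_rpow_of_nonpos (japaneseBracket_pos _)
            ((japaneseBracket_le _).trans ?_) (by linarith)
          rw [norm_smul, Real.norm_of_nonneg (by positivity)]
          have : ‖ξ‖ ≤ 1 := hξ.trans (inv_le_one_of_one_le₀ hN)
          nlinarith [Real.pi_gt_three]
      have h2 := le_mul_of_ofReal_le (b := N⁻¹ ^ ((d : ℝ) - d * (r⁻¹).toReal) * K)
        (h1.trans (h _))
        (by rw [sobolevNorm_testData, eLpNorm_testData_scaled,
              ENNReal.ofReal_mul (by positivity), ENNReal.ofReal_toReal hfin])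
        (by positivity)
      rw [← Real.rpow_natCast N⁻¹ d, mul_assoc m, ← Real.rpow_add hR, ← sub_eq_add_neg,
        Real.mul_rpow hδ0.le (by positivity), ← Real.rpow_mul hN0.le, Real.inv_rpow hN0.le,
        Real.inv_rpow hN0.le, ← Real.rpow_neg hN0.le, ← Real.rpow_neg hN0.le] at h2
      rw [Real.rpow_add hN0]
      linarith
  linarith

/-- Data at frequency scale `R`, focusing at time `t₀`. The bound `t₀ ≤ 1/2` keeps a time interval of
length comparable to `R⁻²` around `t₀` inside `[-1, 1]`. -/
lemma StrichartzEstimate.high_frequency (hs : 0 ≤ s) (hI : Icc (-1) 1 ⊆ I) (hp : p ≠ 0)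
    (hq : q ≠ 0) {t₀ β K : ℝ} (ht₀ : 0 ≤ t₀) (ht₀' : t₀ ≤ 1 / 2) (hK0 : 0 ≤ K)
    (hK : ∀ (R : ℝ) (hR : 0 < R),
      eLpNorm (testData 0 t₀ hR (0 : E)) r volume ≤ ENNReal.ofReal (K * R ^ β))
    (h : StrichartzEstimate d I s p q r) :
    (d : ℝ) - d * (q⁻¹).toReal - 2 * (p⁻¹).toReal - β ≤ s := by
  obtain ⟨C, h⟩ := h
  obtain ⟨c, hc, hlow⟩ := exists_le_eLpNorm_eLpNorm d hp hq
  set δ : ℝ := (8 * π ^ 2)⁻¹ with hδ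
  have hδ0 : 0 < δ := by positivity
  have hδ1 : δ ≤ 1 / 2 := by
    rw [hδ, one_div]
    exact inv_anti₀ (by norm_num) (by nlinarith [Real.pi_gt_three])
  have key := le_of_forall_mul_rpow_le
    (c := c * (1 + 2 * π) ^ (-s) * δ ^ (p⁻¹).toReal)
    (α := -s + (d - d * (q⁻¹).toReal) + (-2) * (p⁻¹).toReal) (β := β)
    (C := C * K) (by positivity)
    fun N hN => by
      have hN0 : 0 < N := by linarith
      have hNδ : δ * N⁻¹ ^ 2 ≤ 1 / 2 := by
        have : N⁻¹ ^ 2 ≤ 1 := pow_le_one₀ (by positivity) (inv_le_one_of_one_le₀ hN)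
        nlinarith
      have h1 := hlow s t₀ N hN0 0 (((1 + 2 * π) * N) ^ (-s)) (δ * N⁻¹ ^ 2) I (by positivity)
        (by positivity) le_rfl
        (fun t ht => hI ⟨by linarith [ht.1], by linarith [ht.2]⟩) fun ξ hξ => by
          rw [sub_zero] at hξ
          refine Real.rpow_le_rpow_of_nonpos (japaneseBracket_pos _)
            ((japaneseBracket_le _).trans ?_) (by linarith)
          rw [norm_smul, Real.norm_of_nonneg (by positivity)]
          nlinarith [Real.pi_gt_three]
      have h2 := le_mul_of_ofReal_le (h1.trans (h _))
        (by rw [sobolevNorm_testData]; exact hK N hN0) (by positivity)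
      have e1 : N⁻¹ ^ 2 = N ^ (-2 : ℝ) := by
        rw [Real.rpow_neg hN0.le, inv_pow]; norm_cast
      rw [e1, ← Real.rpow_natCast N d, mul_assoc (_ ^ (-s)), ← Real.rpow_add hN0,
        ← sub_eq_add_neg, Real.mul_rpow hδ0.le (by positivity), ← Real.rpow_mul hN0.le,
        Real.mul_rpow (by positivity) hN0.le] at h2
      rw [Real.rpow_add hN0, Real.rpow_add hN0]
      linarith
  linarith

/-- For `r ≤ 2` the data focus at time `0`, for `r ≥ 2` at time `1/2`. -/
lemma StrichartzEstimate.le (hs : 0 ≤ s) (hI : Icc (-1) 1 ⊆ I) (hp : p ≠ 0) (hq : q ≠ 0)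
    (hr : 1 ≤ r) (h : StrichartzEstimate d I s p q r) :
    (d : ℝ) - d * (q⁻¹).toReal - 2 * (p⁻¹).toReal - d * (r⁻¹).toReal ≤ s := by
  rcases le_total 2 r with hr2 | hr2
  · obtain ⟨K, hK0, hK⟩ := exists_eLpNorm_testData_half_le d hr2
    exact h.high_frequency hs hI hp hq (by norm_num) le_rfl hK0.le hK
  · have hfin := ((testData 0 0 one_pos (0 : E)).eLpNorm_lt_top r).ne
    have h1 := h.high_frequency hs hI hp hq (t₀ := 0) (β := d - d * (r⁻¹).toReal)
      (K := (eLpNorm (testData 0 0 one_pos (0 : E)) r volume).toReal) le_rfl (by norm_num)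
      ENNReal.toReal_nonneg fun R hR => by
        rw [eLpNorm_testData_scaled, mul_comm (ENNReal.toReal _),
          ENNReal.ofReal_mul (by positivity), ENNReal.ofReal_toReal hfin]
    have h2 : (1 / 2 : ℝ) ≤ (r⁻¹).toReal := by
      have := ENNReal.toReal_mono (ENNReal.inv_ne_top.2 (lt_of_lt_of_le one_pos hr).ne')
        (ENNReal.inv_le_inv.2 hr2)
      simpa using this
    have h3 : (0 : ℝ) ≤ d := Nat.cast_nonneg d
    nlinarith

lemma StrichartzEstimate.exponent_le (hd : 1 ≤ d) (hs : 0 ≤ s) (hI : Icc (-1) 1 ⊆ I) (hp : p ≠ 0)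
    (hq : 1 ≤ q) (hr : 1 ≤ r) (h : StrichartzEstimate d I s p q r) : r ≤ q := by
  have h1 := h.low_frequency hs hp (lt_of_lt_of_le one_pos hq).ne' (γ := 0) (by norm_num)
    fun N _ t ht => by
      have hδ1 : (8 * π ^ 2)⁻¹ ≤ 1 := inv_le_one_of_one_le₀ (by nlinarith [Real.pi_gt_three])
      rw [Real.rpow_zero, mul_one] at ht
      exact hI ⟨by linarith [ht.1], by linarith [ht.2]⟩
  have hd' : (0 : ℝ) < d := by exact_mod_cast hd
  rw [zero_mul, zero_add] at h1
  have h2 := le_of_mul_le_mul_left h1 hd'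
  rwa [ENNReal.toReal_le_toReal (ENNReal.inv_ne_top.2 (lt_of_lt_of_le one_pos hq).ne')
    (ENNReal.inv_ne_top.2 (lt_of_lt_of_le one_pos hr).ne'), ENNReal.inv_le_inv] at h2

end strichartz

end

theorem proposition1p2 (d : ℕ) (hd : 1 ≤ d) (s : ℝ) (p : ℝ≥0∞) (hp : 2 ≤ p) :
    (∀ (σ : EuclideanSpace ℝ (Fin d) → ℂ) (q : ℝ≥0∞), IsUniformPartition σ → 1 ≤ q →
      ModulationSmoothing d σ s p q →
        max 0 ((d : ℝ) - (d + 2) * (p⁻¹).toReal - d * (q⁻¹).toReal) ≤ s) ∧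
    (∀ q r : ℝ≥0∞, 1 ≤ q → 1 ≤ r →
      (StrichartzEstimate d (Icc (-1) 1) s p q r →
        max 0 ((d : ℝ) - d * (q⁻¹).toReal - 2 * (p⁻¹).toReal - d * (r⁻¹).toReal) ≤ s ∧
          r ≤ q) ∧
      (StrichartzEstimate d univ s p q r →
        max 0 ((d : ℝ) - d * (q⁻¹).toReal - 2 * (p⁻¹).toReal - d * (r⁻¹).toReal) ≤ s ∧
          r ≤ q ∧
          2 * (p⁻¹).toReal + d * (q⁻¹).toReal ≤ d * (r⁻¹).toReal)) := by
  have hp0 : p ≠ 0 := (lt_of_lt_of_le (by norm_num) hp).ne'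
  have strichartz : ∀ (I : Set ℝ) (q r : ℝ≥0∞), Icc (-1) 1 ⊆ I → 1 ≤ q → 1 ≤ r →
      StrichartzEstimate d I s p q r → 0 ≤ s ∧
        max 0 ((d : ℝ) - d * (q⁻¹).toReal - 2 * (p⁻¹).toReal - d * (r⁻¹).toReal) ≤ s ∧
          r ≤ q := by
    intro I q r hI hq hr h
    have hq0 : q ≠ 0 := (lt_of_lt_of_le one_pos hq).ne'
    have hs := h.nonneg hd hI hp0 hq0
    exact ⟨hs, max_le hs (h.le hs hI hp0 hq0 hr), h.exponent_le hd hs hI hp0 hq hr⟩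
  refine ⟨fun σ q hσ _ h => ?_, fun q r hq hr => ⟨fun h => ?_, fun h => ?_⟩⟩
  · have hs := h.nonneg hd hσ hp
    exact max_le hs (by linarith [h.le hσ hp hs])
  · exact (strichartz _ q r subset_rfl hq hr h).2
  · obtain ⟨hs, h1, h2⟩ := strichartz _ q r (subset_univ _) hq hr h
    exact ⟨h1, h2, h.low_frequency hs hp0 (lt_of_lt_of_le one_pos hq).ne' le_rfl
      fun _ _ => subset_univ _⟩
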